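/- For integers $k\ge 1$ put $H(k)=\sum_{j=1}^{k-1}\frac{1}{(2j)^2}$ (so $H(1)=0$). Let $n\ge 0$ be an integer and let $x$ be a real number with $|x|\le 1$, and $x\ne 0$ if $n\geq 1$; empty sums are $0$ and $(2x)^0=1$. Then the series $$S_n(x)=\sum_{k=1}^\infty\frac{4^kH(k)x^{2k}}{\binom{2k}{k}k(2k+n)}$$ converges, and its value is as follows. If $n$ is even, $$\begin{aligned} S_n(x)=\frac{\binom{n}{n/2}}{2\,(2x)^{n}} \Bigg(&\frac{\arcsin^4 x}{6}-\frac{\sqrt{1-x^2}}{3}\arcsin^3 x \sum_{j=0}^{\frac{n-2}{2}}\frac{(2x)^{2j+1}}{\binom{2j}{j}(2j+1)} +\frac{\arcsin^2 x}{2}\sum_{j=1}^{n/2}\bigg(\frac{(2x)^{2j}}{\binom{2j}{j}}-1\bigg)\frac{1}{j^2}\\ &+\frac{\sqrt{1-x^2}}{2}\arcsin x \sum_{r=0}^{\frac{n-2}{2}}\bigg(\sum_{j=r+1}^{n/2}\frac{1}{j^2}\bigg)\frac{(2x)^{2r+1}}{\binom{2r}{r}(2r+1)} -\frac{1}{4}\sum_{r=1}^{n/2}\bigg(\sum_{j=r}^{n/2}\frac{1}{j^2}\bigg)\frac{(2x)^{2r}}{\binom{2r}{r}r^2}\Bigg),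 \end{aligned}$$ and if $n$ is odd, $$\begin{aligned} S_n(x)=\frac{(2/x)^n}{n\binom{n-1}{\frac{n-1}{2}}} \Bigg(&-\frac{\sqrt{1-x^2}}{6}\arcsin^3 x\sum_{j=0}^{\frac{n-1}{2}}\binom{2j}{j}\Big(\frac{x}{2}\Big)^{2j} +\arcsin^2 x\sum_{j=0}^{\frac{n-1}{2}}\frac{\binom{2j}{j}\left(\frac{x}{2}\right)^{2j+1}}{2j+1}\\ &+\sqrt{1-x^2}\,\arcsin x\sum_{r=0}^{\frac{n-1}{2}}\bigg(\sum_{j=r}^{\frac{n-1}{2}}\frac{1}{(2j+1)^2}\bigg)\binom{2r}{r}\Big(\frac{x}{2}\Big)^{2r}\\ &-2\sum_{r=0}^{\frac{n-1}{2}}\bigg(\sum_{j=r}^{\frac{n-1}{2}}\frac{1}{(2j+1)^2}\bigg)\frac{\binom{2r}{r}\left(\frac{x}{2}\right)^{2r+1}}{2r+1}\Bigg). \end{aligned}$$ -/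

import Mathlib

/-- The generalized harmonic number `H(k) = ∑_{j=1}^{k-1} 1 / (2j)^2`. -/
noncomputable def genHarmonic (k : ℕ) : ℝ :=
  ∑ j ∈ Finset.Ico 1 k, 1 / (2 * (j : ℝ)) ^ 2

/-- The `k`-th term `4^k H(k) x^(2k) / (binom(2k,k) k (2k+n))` of the series (used for `k ≥ 1`). -/
noncomputable def seriesTerm (n : ℕ) (x : ℝ) (k : ℕ) : ℝ :=
  4 ^ k * genHarmonic k * x ^ (2 * k) /
    (((2 * k).choose k : ℝ) * (k : ℝ) * (2 * (k : ℝ) + (n : ℝ)))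

/-! Put `x = sin θ` and `c k = 4^k / binom(2k,k)`. Differentiating `x^n S_n(x)` termwise in `θ`
gives `sin^n θ` times `cos θ ∑ H(k) (c k / k) sin^(2k-1) θ`, and this last factor is `θ^3/3`, half
the derivative of the expansion of `θ^4/6` in powers of `sin θ`. Hence `x^n S_n(x)` is the integral
of `t^3 sin^n t / 3` from `0` to `arcsin x`.

The expansion comes with an explicit remainder: derivatives of partial sums telescope
(`hasDerivAt_cos_mul_sqPartialAux`, `hasDerivAt_cos_mul_quartPartialAux`), and the mean value
inequality bounds what is left. This settles `|x| < 1`; nonnegativity of the terms and a limit along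
`s * x`, `s → 1⁻`, settle `|x| = 1` (`hasSum_seriesTerm`).

The integral is evaluated by integration by parts, lowering the exponent of the sine by 2,
separately for even and odd `n` (`hasDerivAt_evenAntideriv`, `hasDerivAt_oddAntideriv`). -/

-- Exchanging the order of summation turns the tail sums of the closed forms into one increment per
-- `j`, the shape in which the antiderivatives are built.
open Finset in
theorem sum_range_sum_Icc_mul (f g : ℕ → ℝ) (m : ℕ) :
    ∑ r ∈ range m, (∑ j ∈ Icc (r + 1) m, f j) * g r =
      ∑ j ∈ range m, f (j + 1) * ∑ r ∈ range (j + 1), g r := by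
  induction m with
  | zero => simp
  | succ m ih =>
    rw [sum_range_succ _ m, sum_range_succ (fun j => f (j + 1) * _) m, ← ih, sum_range_succ g m,
      mul_add, mul_sum, ← add_assoc, ← sum_add_distrib]
    congr 1
    · refine sum_congr rfl fun r hr => ?_
      rw [sum_Icc_succ_top (by have := mem_range.1 hr; omega), add_mul]
    · simp

theorem sum_Icc_one_eq_sum_range (f : ℕ → ℝ) (m : ℕ) :
    ∑ j ∈ Finset.Icc 1 m, f j = ∑ j ∈ Finset.range m, f (j + 1) := by
  induction m with
  | zero => simp
  | succ m ih => rw [Finset.sum_Icc_succ_top (by omega), ih, Finset.sum_range_succ]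

theorem sum_Icc_eq_sum_Icc_succ (f : ℕ → ℝ) (r m : ℕ) :
    ∑ j ∈ Finset.Icc r m, f j = ∑ j ∈ Finset.Icc (r + 1) (m + 1), f (j - 1) := by
  rw [← Finset.map_add_right_Icc r m 1, Finset.sum_map]
  simp

/-! ### Coefficients and their growth -/

/-- The ratio `4^k / binom(2k,k)`. -/
noncomputable def fourPowDivCentralBinom (k : ℕ) : ℝ := 4 ^ k / (k.centralBinom : ℝ)

local notation "c" => fourPowDivCentralBinom

theorem fourPowDivCentralBinom_zero : c 0 = 1 := by simp [fourPowDivCentralBinom]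

theorem fourPowDivCentralBinom_pos (k : ℕ) : 0 < c k := by
  have := Nat.centralBinom_pos k
  unfold fourPowDivCentralBinom
  positivity

theorem fourPowDivCentralBinom_succ (k : ℕ) :
    c (k + 1) = c k * (2 * k + 2) / (2 * k + 1) := by
  have h : ((k : ℝ) + 1) * (k + 1).centralBinom = 2 * (2 * k + 1) * k.centralBinom := by
    exact_mod_cast Nat.succ_mul_centralBinom_succ k
  have h0 : (0 : ℝ) < k.centralBinom := by exact_mod_cast Nat.centralBinom_pos k
  have h1 : (0 : ℝ) < (k + 1).centralBinom := by exact_mod_cast Nat.centralBinom_pos (k + 1)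
  unfold fourPowDivCentralBinom
  field_simp
  linear_combination (-2 : ℝ) * 4 ^ k * h

/-- Any polynomial bound is enough, since the remainders carry a factor `sin b ^ (2 * m)` with `sin
b < 1`. -/
theorem fourPowDivCentralBinom_le (k : ℕ) : c k ≤ 2 * k + 1 := by
  induction k with
  | zero => simp [fourPowDivCentralBinom_zero]
  | succ k ih =>
    rw [fourPowDivCentralBinom_succ, div_le_iff₀ (by positivity)]
    push_cast
    nlinarith

theorem genHarmonic_succ (k : ℕ) :
    genHarmonic (k + 2) = genHarmonic (k + 1) + 1 / (2 * ((k : ℝ) + 1)) ^ 2 := by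
  unfold genHarmonic
  rw [Finset.sum_Ico_succ_top (by omega)]
  push_cast
  rfl

theorem genHarmonic_one : genHarmonic 1 = 0 := by simp [genHarmonic]

theorem genHarmonic_nonneg (k : ℕ) : 0 ≤ genHarmonic k :=
  Finset.sum_nonneg fun _ _ => by positivity

theorem genHarmonic_succ_le (k : ℕ) : genHarmonic (k + 1) ≤ k := by
  induction k with
  | zero => simp [genHarmonic_one]
  | succ k ih =>
    rw [genHarmonic_succ]
    have : 1 / (2 * ((k : ℝ) + 1)) ^ 2 ≤ 1 := by
      rw [div_le_one (by positivity)]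
      nlinarith [(Nat.cast_nonneg k : (0 : ℝ) ≤ k)]
    push_cast
    linarith

/-! ### Expansions of `2θ²` and `θ⁴/6` in powers of `sin θ`, with remainders -/

open Real Finset

/-- Partial sums of the series of `2 θ ^ 2` in powers of `sin θ`. -/
noncomputable def sqPartial (m : ℕ) (t : ℝ) : ℝ :=
  ∑ k ∈ range m, c (k + 1) / ((k : ℝ) + 1) ^ 2 * sin t ^ (2 * k + 2)

/-- The sum with `2 * cos * sqPartialAux = sqPartial'`. -/
noncomputable def sqPartialAux (m : ℕ) (t : ℝ) : ℝ :=
  ∑ k ∈ range m, c (k + 1) / ((k : ℝ) + 1) * sin t ^ (2 * k + 1)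

/-- Partial sums of the series of `θ ^ 4 / 6` in powers of `sin θ`. -/
noncomputable def quartPartial (m : ℕ) (t : ℝ) : ℝ :=
  ∑ k ∈ range m, genHarmonic (k + 1) * (c (k + 1) / ((k : ℝ) + 1) ^ 2) * sin t ^ (2 * k + 2)

/-- The sum with `2 * cos * quartPartialAux = quartPartial'`. -/
noncomputable def quartPartialAux (m : ℕ) (t : ℝ) : ℝ :=
  ∑ k ∈ range m, genHarmonic (k + 1) * (c (k + 1) / ((k : ℝ) + 1)) * sin t ^ (2 * k + 1)

theorem hasDerivAt_sin_pow_succ (m : ℕ) (t : ℝ) :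
    HasDerivAt (fun t => sin t ^ (m + 1)) (((m : ℝ) + 1) * sin t ^ m * cos t) t := by
  simpa using (hasDerivAt_sin t).fun_pow (m + 1)

/-- The recurrence for `c` makes the derivative a difference of consecutive terms of one sequence,
so sums over `k` telescope. -/
theorem hasDerivAt_cos_mul_sin_pow (k : ℕ) (t : ℝ) :
    HasDerivAt (fun t => cos t * (c (k + 1) / ((k : ℝ) + 1) * sin t ^ (2 * k + 1)))
      (2 * c k * sin t ^ (2 * k) - 2 * c (k + 1) * sin t ^ (2 * (k + 1))) t := by
  refine ((hasDerivAt_cos t).mul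
    ((hasDerivAt_sin_pow_succ (2 * k) t).const_mul (c (k + 1) / ((k : ℝ) + 1)))).congr_deriv ?_
  have h : cos t ^ 2 = 1 - sin t ^ 2 := by rw [← sin_sq_add_cos_sq t]; ring
  have e : c (k + 1) / ((k : ℝ) + 1) * (2 * k + 1) = 2 * c k := by
    rw [fourPowDivCentralBinom_succ]; field_simp
  have e' : c (k + 1) / ((k : ℝ) + 1) * (2 * k + 2) = 2 * c (k + 1) := by
    field_simp
  push_cast
  linear_combination (c (k + 1) / ((k : ℝ) + 1) * (2 * k + 1) * sin t ^ (2 * k)) * h +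
    sin t ^ (2 * k) * e - sin t ^ (2 * k) * sin t ^ 2 * e'

theorem hasDerivAt_cos_mul_sqPartialAux (m : ℕ) (t : ℝ) :
    HasDerivAt (fun t => cos t * sqPartialAux m t) (2 - 2 * c m * sin t ^ (2 * m)) t := by
  induction m with
  | zero => simpa [sqPartialAux, fourPowDivCentralBinom_zero] using hasDerivAt_const t (0 : ℝ)
  | succ m ih =>
    simp only [sqPartialAux, sum_range_succ, mul_add] at ih ⊢
    exact (ih.add (hasDerivAt_cos_mul_sin_pow m t)).congr_deriv (by ring)

theorem hasDerivAt_sqPartial (m : ℕ) (t : ℝ) :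
    HasDerivAt (sqPartial m) (2 * (cos t * sqPartialAux m t)) t := by
  unfold sqPartial sqPartialAux
  refine (HasDerivAt.fun_sum fun k _ => (hasDerivAt_sin_pow_succ (2 * k + 1) t).const_mul
    (c (k + 1) / ((k : ℝ) + 1) ^ 2)).congr_deriv ?_
  rw [mul_sum, mul_sum]
  refine sum_congr rfl fun k _ => ?_
  push_cast
  field_simp
  ring

theorem hasDerivAt_quartPartial (m : ℕ) (t : ℝ) :
    HasDerivAt (quartPartial m) (2 * (cos t * quartPartialAux m t)) t := by
  unfold quartPartial quartPartialAux
  refine (HasDerivAt.fun_sum fun k _ => (hasDerivAt_sin_pow_succ (2 * k + 1) t).const_mul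
    (genHarmonic (k + 1) * (c (k + 1) / ((k : ℝ) + 1) ^ 2))).congr_deriv ?_
  rw [mul_sum, mul_sum]
  refine sum_congr rfl fun k _ => ?_
  push_cast
  field_simp
  ring

/-- Summation by parts: the increments `1 / (2(k+1))^2` of `genHarmonic` against the telescoping
terms produce half of `sqPartial`. -/
theorem hasDerivAt_cos_mul_quartPartialAux (m : ℕ) (t : ℝ) :
    HasDerivAt (fun t => cos t * quartPartialAux m t)
      (sqPartial m t / 2 - 2 * genHarmonic (m + 1) * c m * sin t ^ (2 * m)) t := by
  induction m with
  | zero => simpa [quartPartialAux, sqPartial, genHarmonic_one] using hasDerivAt_const t (0 : ℝ)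
  | succ m ih =>
    simp only [quartPartialAux, sqPartial, sum_range_succ, mul_add] at ih ⊢
    have h := ih.add ((hasDerivAt_cos_mul_sin_pow m t).const_mul (genHarmonic (m + 1)))
    refine (h.congr_deriv ?_).congr_of_eventuallyEq (.of_forall fun s => ?_)
    · rw [genHarmonic_succ]
      field_simp
      ring
    · simp only [Pi.add_apply]
      ring

theorem abs_le_mul_of_hasDerivAt {f g : ℝ → ℝ} (hd : ∀ t, HasDerivAt f (g t) t) (h0 : f 0 = 0)
    {b M : ℝ} (hb : ∀ t, |t| ≤ b → |g t| ≤ M) {t : ℝ} (ht : |t| ≤ b) : |f t| ≤ M * b := by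
  have hb0 : 0 ≤ b := (abs_nonneg t).trans ht
  have h := (convex_Icc (-b) b).norm_image_sub_le_of_norm_hasDerivWithin_le
    (fun s _ => (hd s).hasDerivWithinAt) (fun s hs => hb s (abs_le.2 hs))
    (show (0 : ℝ) ∈ Set.Icc (-b) b from ⟨by linarith, hb0⟩) (abs_le.1 ht)
  simp only [h0, sub_zero, norm_eq_abs] at h
  have hM : 0 ≤ M := (abs_nonneg _).trans (hb t ht)
  exact h.trans (by gcongr)

theorem abs_sin_le_sin {t b : ℝ} (ht : |t| ≤ b) (hb : b ≤ π / 2) : |sin t| ≤ sin b := by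
  obtain ⟨h1, h2⟩ := abs_le.1 ht
  refine abs_le.2 ⟨?_, sin_le_sin_of_le_of_le_pi_div_two (by linarith) hb h2⟩
  rw [← sin_neg]
  exact sin_le_sin_of_le_of_le_pi_div_two (by linarith) (by linarith) h1

/-- Bound on the remainder of `2 θ^2`. -/
theorem abs_two_mul_sq_sub_sqPartial_le (m : ℕ) {t b : ℝ} (ht : |t| ≤ b) (hb : b ≤ π / 2) :
    |2 * t ^ 2 - sqPartial m t| ≤ 4 * c m * sin b ^ (2 * m) * b * b := by
  refine abs_le_mul_of_hasDerivAt (f := fun t => 2 * t ^ 2 - sqPartial m t)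
    (g := fun t => 4 * t - 2 * (cos t * sqPartialAux m t)) (fun s => ?_) ?_ (fun s hs => ?_) ht
  · refine (((hasDerivAt_id s).fun_pow 2).const_mul 2 |>.sub
      (hasDerivAt_sqPartial m s)).congr_deriv ?_
    simp
    ring
  · simp [sqPartial]
  -- The mean value bound is applied a second time: the second derivative of the remainder is the
  -- single term `4 * c m * sin t ^ (2 * m)`.
  refine abs_le_mul_of_hasDerivAt (f := fun t => 4 * t - 2 * (cos t * sqPartialAux m t))
    (g := fun t => 4 * c m * sin t ^ (2 * m)) (fun s => ?_) ?_ (fun s hs => ?_) hs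
  · refine (((hasDerivAt_id s).const_mul 4).sub
      ((hasDerivAt_cos_mul_sqPartialAux m s).const_mul 2)).congr_deriv ?_
    ring
  · simp [sqPartialAux]
  · have := fourPowDivCentralBinom_pos m
    rw [abs_mul, abs_of_pos (by positivity : 0 < 4 * c m), abs_pow]
    gcongr
    exact abs_sin_le_sin hs hb

/-- Bound on the derivative of the remainder of `θ^4 / 6`. -/
theorem abs_cube_sub_quartPartialAux_le (m : ℕ) {t b : ℝ} (ht : |t| ≤ b) (hb : b ≤ π / 2) :
    |t ^ 3 / 3 - cos t * quartPartialAux m t| ≤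
      2 * c m * sin b ^ (2 * m) * (b * b + genHarmonic (m + 1)) * b := by
  refine abs_le_mul_of_hasDerivAt (f := fun t => t ^ 3 / 3 - cos t * quartPartialAux m t)
    (g := fun t => (2 * t ^ 2 - sqPartial m t) / 2 +
      2 * genHarmonic (m + 1) * c m * sin t ^ (2 * m)) (fun s => ?_) ?_ (fun s hs => ?_) ht
  · refine ((((hasDerivAt_id s).fun_pow 3).div_const 3).sub
      (hasDerivAt_cos_mul_quartPartialAux m s)).congr_deriv ?_
    simp
    ring
  · simp [quartPartialAux]
  · have h1 := abs_two_mul_sq_sub_sqPartial_le m hs hb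
    have h2 : |2 * genHarmonic (m + 1) * c m * sin s ^ (2 * m)| ≤
        2 * genHarmonic (m + 1) * c m * sin b ^ (2 * m) := by
      have := fourPowDivCentralBinom_pos m
      have := genHarmonic_nonneg (m + 1)
      rw [abs_mul, abs_of_nonneg (by positivity : 0 ≤ 2 * genHarmonic (m + 1) * c m), abs_pow]
      gcongr
      exact abs_sin_le_sin hs hb
    refine (abs_add_le _ _).trans ?_
    rw [abs_div, abs_two]
    linarith

/-! ### The sum of the series as an integral -/

theorem seriesTerm_succ (n k : ℕ) (x : ℝ) :
    seriesTerm n x (k + 1) = genHarmonic (k + 1) * (c (k + 1) / ((k : ℝ) + 1)) *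
      (x ^ (2 * k + 2) / (2 * k + 2 + n)) := by
  unfold seriesTerm fourPowDivCentralBinom
  rw [Nat.centralBinom_eq_two_mul_choose]
  have : ((2 * (k + 1)).choose (k + 1) : ℝ) ≠ 0 := by
    exact_mod_cast (Nat.choose_pos (by omega)).ne'
  push_cast
  rw [mul_add 2 k 1]
  field_simp

theorem seriesTerm_succ_nonneg (n k : ℕ) (x : ℝ) : 0 ≤ seriesTerm n x (k + 1) := by
  rw [seriesTerm_succ]
  have := fourPowDivCentralBinom_pos (k + 1)
  have := genHarmonic_nonneg (k + 1)
  have : 0 ≤ x ^ (2 * k + 2) := Even.pow_nonneg ⟨k + 1, by ring⟩ x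
  positivity

theorem hasDerivAt_sin_pow_mul_sum (n m : ℕ) (t : ℝ) :
    HasDerivAt (fun t => sin t ^ n * ∑ k ∈ range m, seriesTerm n (sin t) (k + 1))
      (sin t ^ n * (cos t * quartPartialAux m t)) t := by
  have e : (fun t => sin t ^ n * ∑ k ∈ range m, seriesTerm n (sin t) (k + 1)) =
      fun t => ∑ k ∈ range m, genHarmonic (k + 1) * (c (k + 1) / ((k : ℝ) + 1)) /
        (2 * k + 2 + n) * sin t ^ (n + 2 * k + 1 + 1) := by
    funext s
    rw [mul_sum]
    refine sum_congr rfl fun k _ => ?_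
    rw [seriesTerm_succ]
    ring
  rw [e]
  refine (HasDerivAt.fun_sum fun k _ =>
    (hasDerivAt_sin_pow_succ (n + 2 * k + 1) t).const_mul _).congr_deriv ?_
  unfold quartPartialAux
  rw [mul_sum, mul_sum]
  refine sum_congr rfl fun k _ => ?_
  push_cast
  have : (n : ℝ) + 2 * k + 1 + 1 ≠ 0 := by positivity
  have : 2 * (k : ℝ) + 2 + n ≠ 0 := by positivity
  field_simp
  ring

open Filter Topology in
/-- An antiderivative of `θ^3 sin^n θ / 3` is `sin^n θ` times the sum of the series. -/
theorem tendsto_sin_pow_mul_sum {n : ℕ} {F : ℝ → ℝ} (h0 : F 0 = 0)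
    (hF : ∀ t, HasDerivAt F (sin t ^ n * (t ^ 3 / 3)) t) {t : ℝ} (ht : |t| < π / 2) :
    Tendsto (fun m => sin t ^ n * ∑ k ∈ range m, seriesTerm n (sin t) (k + 1)) atTop
      (𝓝 (F t)) := by
  set b := |t| with hb
  have hb0 : 0 ≤ b := abs_nonneg t
  have hs0 : 0 ≤ sin b := sin_nonneg_of_nonneg_of_le_pi hb0 (by linarith [pi_pos])
  have hs1 : sin b < 1 := by
    rw [← sin_pi_div_two]
    exact sin_lt_sin_of_lt_of_le_pi_div_two (by linarith [pi_pos]) le_rfl ht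
  have key : ∀ m : ℕ, |F t - sin t ^ n * ∑ k ∈ range m, seriesTerm n (sin t) (k + 1)| ≤
      2 * (2 * m + 1) * (sin b ^ 2) ^ m * (b * b + m) * b * b := by
    intro m
    refine abs_le_mul_of_hasDerivAt
      (f := fun t => F t - sin t ^ n * ∑ k ∈ range m, seriesTerm n (sin t) (k + 1))
      (fun s => (hF s).sub (hasDerivAt_sin_pow_mul_sum n m s)) ?_ (fun s hs => ?_) le_rfl
    · simp [h0, seriesTerm_succ]
    · rw [← mul_sub, abs_mul, abs_pow]
      have h1 : |sin s| ^ n ≤ 1 := pow_le_one₀ (abs_nonneg _) (abs_sin_le_one s)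
      refine (mul_le_of_le_one_left (abs_nonneg _) h1).trans ?_
      refine (abs_cube_sub_quartPartialAux_le m hs ht.le).trans ?_
      rw [← pow_mul]
      have := genHarmonic_nonneg (m + 1)
      gcongr
      · exact fourPowDivCentralBinom_le m
      · exact genHarmonic_succ_le m
  have hr : |sin b ^ 2| < 1 := by
    rw [abs_of_nonneg (sq_nonneg _)]
    exact pow_lt_one₀ hs0 hs1 two_ne_zero
  have hlim : Tendsto (fun m : ℕ => 2 * (2 * (m : ℝ) + 1) * (sin b ^ 2) ^ m * (b * b + m) * b * b)
      atTop (𝓝 0) := by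
    -- The bound is a quadratic polynomial in `m` times a geometric term; each monomial is treated
    -- separately.
    have h2 := tendsto_pow_const_mul_const_pow_of_abs_lt_one 2 hr
    have h1 := tendsto_pow_const_mul_const_pow_of_abs_lt_one 1 hr
    have h0 := tendsto_pow_const_mul_const_pow_of_abs_lt_one 0 hr
    have h := ((h2.const_mul (4 * b * b)).add (h1.const_mul ((2 + 4 * b * b) * b * b))).add
      (h0.const_mul (2 * b * b * b * b))
    simp only [mul_zero, add_zero] at h
    refine h.congr fun m => ?_
    ring
  rw [tendsto_iff_dist_tendsto_zero]
  refine squeeze_zero (fun _ => dist_nonneg) (fun m => ?_) hlim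
  rw [dist_comm, Real.dist_eq]
  exact key m

open Filter Topology in
theorem hasSum_seriesTerm {n : ℕ} {F : ℝ → ℝ} (h0 : F 0 = 0)
    (hF : ∀ t, HasDerivAt F (sin t ^ n * (t ^ 3 / 3)) t) {x : ℝ} (hx : |x| ≤ 1)
    (hx0 : n = 0 ∨ x ≠ 0) :
    HasSum (fun i : ℕ => seriesTerm n x (i + 1)) (F (arcsin x) / x ^ n) := by
  have hpow : ∀ {y : ℝ}, n = 0 ∨ y ≠ 0 → y ^ n ≠ 0 := by
    rintro y (rfl | h)
    · simp
    · exact pow_ne_zero n h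
  have hint : ∀ y : ℝ, |y| < 1 → (n = 0 ∨ y ≠ 0) →
      HasSum (fun i : ℕ => seriesTerm n y (i + 1)) (F (arcsin y) / y ^ n) := by
    intro y hy hy0
    obtain ⟨h1, h2⟩ := abs_lt.1 hy
    rw [hasSum_iff_tendsto_nat_of_nonneg fun i => seriesTerm_succ_nonneg n i y]
    have h := tendsto_sin_pow_mul_sum h0 hF (t := arcsin y)
      (abs_lt.2 ⟨neg_pi_div_two_lt_arcsin.2 h1, arcsin_lt_pi_div_two.2 h2⟩)
    rw [sin_arcsin h1.le h2.le] at h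
    refine (h.div_const (y ^ n)).congr fun m => ?_
    rw [mul_div_cancel_left₀ _ (hpow hy0)]
  rcases hx.lt_or_eq with h1 | h1
  · exact hint x h1 hx0
  have hxne : x ≠ 0 := by rintro rfl; simp at h1
  have hFc : Continuous F := continuous_iff_continuousAt.2 fun t => (hF t).continuousAt
  have htend : Tendsto (fun s : ℝ => s * x) (𝓝[<] 1) (𝓝 x) := by
    have : Tendsto (fun s : ℝ => s * x) (𝓝 1) (𝓝 (1 * x)) := by
      exact (continuous_id.mul continuous_const).tendsto 1
    rw [one_mul] at this
    exact this.mono_left nhdsWithin_le_nhds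
  have hV : Tendsto (fun s : ℝ => F (arcsin (s * x)) / (s * x) ^ n) (𝓝[<] 1)
      (𝓝 (F (arcsin x) / x ^ n)) :=
    (((hFc.comp continuous_arcsin).tendsto x).comp htend).div (htend.pow n) (hpow hx0)
  have hev : ∀ᶠ s : ℝ in 𝓝[<] 1, 0 < s ∧ s < 1 :=
    Ioo_mem_nhdsLT (by norm_num : (0 : ℝ) < 1)
  have hsum : ∀ s : ℝ, 0 < s ∧ s < 1 →
      HasSum (fun i : ℕ => seriesTerm n (s * x) (i + 1)) (F (arcsin (s * x)) / (s * x) ^ n) := by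
    rintro s ⟨hs0, hs1⟩
    refine hint _ ?_ (Or.inr (mul_ne_zero hs0.ne' hxne))
    rw [abs_mul, h1, abs_of_pos hs0, mul_one]
    exact hs1
  -- At `|x| = 1` the value is the supremum of the finite sums. It bounds them because finite sums
  -- are continuous in `x`; it is the least bound because each term at `s * x` is at most the term
  -- at `x`.
  refine hasSum_of_isLUB_of_nonneg _ (fun i => seriesTerm_succ_nonneg n i x) ⟨?_, ?_⟩
  · rintro _ ⟨S, rfl⟩
    have hc : Continuous fun y : ℝ => ∑ i ∈ S, seriesTerm n y (i + 1) := by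
      unfold seriesTerm
      fun_prop
    refine le_of_tendsto_of_tendsto ((hc.tendsto x).comp htend) hV ?_
    filter_upwards [hev] with s hs
    exact sum_le_hasSum S (fun i _ => seriesTerm_succ_nonneg n i _) (hsum s hs)
  · intro B hB
    refine le_of_tendsto hV ?_
    filter_upwards [hev] with s hs
    refine hasSum_le_of_sum_le (hsum s hs) fun S => le_trans (sum_le_sum fun i _ => ?_) (hB ⟨S, rfl⟩)
    rw [seriesTerm_succ, seriesTerm_succ]
    have := fourPowDivCentralBinom_pos (i + 1)
    have := genHarmonic_nonneg (i + 1)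
    have h2 : (s * x) ^ (2 * i + 2) ≤ x ^ (2 * i + 2) := by
      rw [mul_pow]
      exact mul_le_of_le_one_left (Even.pow_nonneg ⟨i + 1, by ring⟩ x)
        (pow_le_one₀ hs.1.le hs.2.le)
    gcongr

/-! ### Integration by parts for even exponents -/

/-- Antiderivative of `2/3 c_m θ^3 sin^(2m) θ`. -/
noncomputable def evenAntideriv (m : ℕ) (t : ℝ) : ℝ :=
  t ^ 4 / 6 + ∑ j ∈ range m,
    (-(t ^ 3 / 3) * (cos t * (c (j + 1) / ((j : ℝ) + 1) * sin t ^ (2 * j + 1))) +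
      1 / ((j : ℝ) + 1) ^ 2 * (t ^ 2 / 2 * (c (j + 1) * sin t ^ (2 * (j + 1)) - 1) +
        t / 2 * (cos t * sqPartialAux (j + 1) t) - sqPartial (j + 1) t / 4))

/-- With the factor `c m`, the `t^3` part of each increment replaces the exponent `2m` by `2m+2`.
The remaining parts cancel the `t^2`, `t` and constant-in-`t` terms this creates; the `-1` offsets
the constant `2` in the derivative of `cos t * sqPartialAux (j + 1) t`. -/
theorem hasDerivAt_evenAntideriv (m : ℕ) (t : ℝ) :
    HasDerivAt (evenAntideriv m) (2 / 3 * c m * t ^ 3 * sin t ^ (2 * m)) t := by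
  induction m with
  | zero =>
    have : evenAntideriv 0 = fun t => t ^ 4 / 6 := by funext s; simp [evenAntideriv]
    rw [this]
    refine (((hasDerivAt_id t).fun_pow 4).div_const 6).congr_deriv ?_
    simp [fourPowDivCentralBinom_zero]
    ring
  | succ m ih =>
    have e : evenAntideriv (m + 1) = fun t => evenAntideriv m t +
      (-(t ^ 3 / 3) * (cos t * (c (m + 1) / ((m : ℝ) + 1) * sin t ^ (2 * m + 1))) +
      1 / ((m : ℝ) + 1) ^ 2 * (t ^ 2 / 2 * (c (m + 1) * sin t ^ (2 * m + 1 + 1) - 1) +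
        t / 2 * (cos t * sqPartialAux (m + 1) t) - sqPartial (m + 1) t / 4)) := by
      funext s
      simp only [evenAntideriv, sum_range_succ]
      ring
    rw [e]
    have hid := hasDerivAt_id' t
    refine (ih.add ((((hid.fun_pow 3).div_const 3).fun_neg.mul (hasDerivAt_cos_mul_sin_pow m t)).add
      (((((hid.fun_pow 2).div_const 2).mul
        (((hasDerivAt_sin_pow_succ (2 * m + 1) t).const_mul (c (m + 1))).sub_const 1)).add
        ((hid.div_const 2).mul (hasDerivAt_cos_mul_sqPartialAux (m + 1) t))).sub
        ((hasDerivAt_sqPartial (m + 1) t).div_const 4)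
        |>.const_mul (1 / ((m : ℝ) + 1) ^ 2)))).congr_deriv ?_
    push_cast
    field_simp
    ring

/-! ### Integration by parts for odd exponents -/

/-- Antiderivative of `(2m)/(6 c_m) θ^3 sin^(2m-1) θ`. -/
noncomputable def oddAntideriv (m : ℕ) (t : ℝ) : ℝ :=
  ∑ j ∈ range m,
    (-(t ^ 3 / 6) * (cos t * (sin t ^ (2 * j) / c j)) +
      t ^ 2 / 2 * (sin t ^ (2 * j + 1) / ((2 * j + 1) * c j)) +
      1 / (2 * (j : ℝ) + 1) ^ 2 * (t * (cos t * ∑ r ∈ range (j + 1), sin t ^ (2 * r) / c r) -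
        ∑ r ∈ range (j + 1), sin t ^ (2 * r + 1) / ((2 * r + 1) * c r)))

theorem hasDerivAt_cos_mul_sin_pow_div (k : ℕ) (t : ℝ) :
    HasDerivAt (fun t => cos t * (sin t ^ (2 * k) / c k))
      (2 * k / c k * sin t ^ (2 * k - 1) -
        2 * (k + 1 : ℕ) / c (k + 1) * sin t ^ (2 * (k + 1) - 1)) t := by
  refine ((hasDerivAt_cos t).mul
    (((hasDerivAt_sin t).fun_pow (2 * k)).div_const (c k))).congr_deriv ?_
  have h : cos t ^ 2 = 1 - sin t ^ 2 := by rw [← sin_sq_add_cos_sq t]; ring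
  have hc := (fourPowDivCentralBinom_pos k).ne'
  rw [fourPowDivCentralBinom_succ]
  -- For `k = 0` the truncated exponent `2 * k - 1` is harmless, its coefficient `2 * k` being zero.
  rcases k with _ | k
  · simp [fourPowDivCentralBinom_zero]
  · have e1 : 2 * (k + 1) - 1 = 2 * k + 1 := by omega
    have e2 : 2 * (k + 1 + 1) - 1 = 2 * k + 3 := by omega
    rw [e1, e2]
    push_cast
    field_simp
    linear_combination 2 * ((k : ℝ) + 1) * sin t ^ (2 * k + 1) * h

theorem hasDerivAt_cos_mul_sum_sin_pow_div (m : ℕ) (t : ℝ) :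
    HasDerivAt (fun t => cos t * ∑ r ∈ range m, sin t ^ (2 * r) / c r)
      (-(2 * m / c m * sin t ^ (2 * m - 1))) t := by
  induction m with
  | zero => simpa using hasDerivAt_const t (0 : ℝ)
  | succ m ih =>
    simp only [sum_range_succ, mul_add]
    exact (ih.add (hasDerivAt_cos_mul_sin_pow_div m t)).congr_deriv (by ring_nf)

theorem hasDerivAt_sum_sin_pow_succ_div (m : ℕ) (t : ℝ) :
    HasDerivAt (fun t => ∑ r ∈ range m, sin t ^ (2 * r + 1) / ((2 * r + 1) * c r))
      (cos t * ∑ r ∈ range m, sin t ^ (2 * r) / c r) t := by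
  refine (HasDerivAt.fun_sum fun k _ =>
    (hasDerivAt_sin_pow_succ (2 * k) t).div_const _).congr_deriv ?_
  rw [mul_sum]
  refine sum_congr rfl fun k _ => ?_
  have hc := (fourPowDivCentralBinom_pos k).ne'
  push_cast
  field_simp

theorem hasDerivAt_oddAntideriv (m : ℕ) (t : ℝ) :
    HasDerivAt (oddAntideriv m) (2 * m / c m * sin t ^ (2 * m - 1) * t ^ 3 / 6) t := by
  induction m with
  | zero =>
    have : oddAntideriv 0 = fun _ => 0 := by funext s; simp [oddAntideriv]
    rw [this]
    simpa using hasDerivAt_const t (0 : ℝ)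
  | succ m ih =>
    have e : oddAntideriv (m + 1) = fun t => oddAntideriv m t +
      (-(t ^ 3 / 6) * (cos t * (sin t ^ (2 * m) / c m)) +
      t ^ 2 / 2 * (sin t ^ (2 * m + 1) / ((2 * m + 1) * c m)) +
      1 / (2 * (m : ℝ) + 1) ^ 2 * (t * (cos t * ∑ r ∈ range (m + 1), sin t ^ (2 * r) / c r) -
        ∑ r ∈ range (m + 1), sin t ^ (2 * r + 1) / ((2 * r + 1) * c r))) := by
      funext s
      simp only [oddAntideriv, sum_range_succ _ m]
    rw [e]
    have hid := hasDerivAt_id' t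
    refine (ih.add (((((hid.fun_pow 3).div_const 6).fun_neg.mul
      (hasDerivAt_cos_mul_sin_pow_div m t)).add (((hid.fun_pow 2).div_const 2).mul
        ((hasDerivAt_sin_pow_succ (2 * m) t).div_const ((2 * m + 1) * c m)))).add
      ((hid.mul (hasDerivAt_cos_mul_sum_sin_pow_div (m + 1) t)).sub
        (hasDerivAt_sum_sin_pow_succ_div (m + 1) t)
        |>.const_mul (1 / (2 * (m : ℝ) + 1) ^ 2)))).congr_deriv ?_
    have e2 : 2 * (m + 1) - 1 = 2 * m + 1 := by omega
    have hc := (fourPowDivCentralBinom_pos m).ne'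
    rw [fourPowDivCentralBinom_succ, e2]
    -- This power, with truncated exponent, cancels between the induction hypothesis and the new
    -- increment, so it can stay opaque.
    generalize sin t ^ (2 * m - 1) = w
    generalize ∑ r ∈ range (m + 1), sin t ^ (2 * r) / c r = Y
    push_cast
    field_simp
    ring

/-! ### Matching the antiderivatives with the closed forms -/

theorem two_mul_pow_div_choose_mul (j : ℕ) (x : ℝ) :
    (2 * x) ^ (2 * j + 1) / (((2 * j).choose j : ℝ) * (2 * (j : ℝ) + 1)) =
      c (j + 1) / ((j : ℝ) + 1) * x ^ (2 * j + 1) := by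
  have h : ((2 * j).choose j : ℝ) ≠ 0 := by exact_mod_cast (Nat.choose_pos (by omega)).ne'
  rw [fourPowDivCentralBinom_succ, fourPowDivCentralBinom, Nat.centralBinom_eq_two_mul_choose,
    mul_pow, pow_succ 2, pow_mul 2]
  norm_num
  field_simp

theorem two_mul_pow_div_choose (j : ℕ) (x : ℝ) :
    (2 * x) ^ (2 * j) / ((2 * j).choose j : ℝ) = c j * x ^ (2 * j) := by
  rw [fourPowDivCentralBinom, Nat.centralBinom_eq_two_mul_choose, mul_pow, pow_mul 2]
  norm_num
  ring

theorem choose_mul_div_two_pow (j : ℕ) (x : ℝ) :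
    ((2 * j).choose j : ℝ) * (x / 2) ^ (2 * j) = x ^ (2 * j) / c j := by
  have h : ((2 * j).choose j : ℝ) ≠ 0 := by exact_mod_cast (Nat.choose_pos (by omega)).ne'
  rw [fourPowDivCentralBinom, Nat.centralBinom_eq_two_mul_choose, div_pow, pow_mul 2]
  norm_num
  field_simp

theorem evenAntideriv_eq (m : ℕ) (t : ℝ) :
    evenAntideriv m t = t ^ 4 / 6
      - cos t / 3 * t ^ 3 *
          ∑ j ∈ range m,
            (2 * sin t) ^ (2 * j + 1) / (((2 * j).choose j : ℝ) * (2 * (j : ℝ) + 1))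
      + t ^ 2 / 2 *
          ∑ j ∈ Icc 1 m,
            ((2 * sin t) ^ (2 * j) / ((2 * j).choose j : ℝ) - 1) * (1 / (j : ℝ) ^ 2)
      + cos t / 2 * t *
          ∑ r ∈ range m,
            (∑ j ∈ Icc (r + 1) m, 1 / (j : ℝ) ^ 2) *
              ((2 * sin t) ^ (2 * r + 1) / (((2 * r).choose r : ℝ) * (2 * (r : ℝ) + 1)))
      - 1 / 4 *
          ∑ r ∈ Icc 1 m,
            (∑ j ∈ Icc r m, 1 / (j : ℝ) ^ 2) *
              ((2 * sin t) ^ (2 * r) / (((2 * r).choose r : ℝ) * (r : ℝ) ^ 2)) := by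
  simp only [two_mul_pow_div_choose_mul]
  simp only [← div_div, two_mul_pow_div_choose, sum_Icc_one_eq_sum_range]
  rw [sum_range_sum_Icc_mul (fun j => 1 / (j : ℝ) ^ 2),
    sum_range_sum_Icc_mul (fun j => 1 / (j : ℝ) ^ 2) fun r =>
      c (r + 1) * sin t ^ (2 * (r + 1)) / ((r + 1 : ℕ) : ℝ) ^ 2]
  simp only [evenAntideriv, sqPartialAux, sqPartial, mul_sum (range m), add_assoc, sub_eq_add_neg,
    ← sum_neg_distrib (s := range m), ← sum_add_distrib (s := range m)]
  congr 1
  refine sum_congr rfl fun j _ => ?_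
  have e : ∀ r : ℕ, c (r + 1) * sin t ^ (2 * (r + 1)) / ((r + 1 : ℕ) : ℝ) ^ 2 =
      c (r + 1) / ((r : ℝ) + 1) ^ 2 * sin t ^ (2 * r + 2) := fun r => by push_cast; ring
  simp only [e]
  push_cast
  ring

theorem oddAntideriv_eq (m : ℕ) (t : ℝ) :
    oddAntideriv (m + 1) t = -(cos t / 6) * t ^ 3 *
          ∑ j ∈ Icc 0 m, ((2 * j).choose j : ℝ) * (sin t / 2) ^ (2 * j)
      + t ^ 2 *
          ∑ j ∈ Icc 0 m, ((2 * j).choose j : ℝ) * (sin t / 2) ^ (2 * j + 1) / (2 * (j : ℝ) + 1)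
      + cos t * t *
          ∑ r ∈ Icc 0 m,
            (∑ j ∈ Icc r m, 1 / (2 * (j : ℝ) + 1) ^ 2) *
              (((2 * r).choose r : ℝ) * (sin t / 2) ^ (2 * r))
      - 2 *
          ∑ r ∈ Icc 0 m,
            (∑ j ∈ Icc r m, 1 / (2 * (j : ℝ) + 1) ^ 2) *
              (((2 * r).choose r : ℝ) * (sin t / 2) ^ (2 * r + 1) / (2 * (r : ℝ) + 1)) := by
  -- The inner sums start at `r`; shifting their index by one gives the range `Icc (r + 1) (m + 1)`
  -- required by `sum_range_sum_Icc_mul`.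
  simp only [pow_succ (sin t / 2), ← mul_assoc _ _ (sin t / 2), choose_mul_div_two_pow,
    sum_Icc_eq_sum_Icc_succ (fun j : ℕ => 1 / (2 * (j : ℝ) + 1) ^ 2)]
  rw [← Nat.range_succ_eq_Icc_zero,
    sum_range_sum_Icc_mul (fun j : ℕ => 1 / (2 * ((j - 1 : ℕ) : ℝ) + 1) ^ 2),
    sum_range_sum_Icc_mul (fun j : ℕ => 1 / (2 * ((j - 1 : ℕ) : ℝ) + 1) ^ 2)]
  simp only [oddAntideriv, mul_sum (range (m + 1)), sub_eq_add_neg,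
    ← sum_neg_distrib (s := range (m + 1)), ← sum_add_distrib (s := range (m + 1))]
  refine sum_congr rfl fun j _ => ?_
  have e : ∑ r ∈ range (j + 1), sin t ^ (2 * r) / c r * (sin t / 2) / (2 * (r : ℝ) + 1) =
      (∑ r ∈ range (j + 1), sin t ^ (2 * r + 1) / ((2 * r + 1) * c r)) / 2 := by
    rw [sum_div]
    refine sum_congr rfl fun r _ => ?_
    have := (fourPowDivCentralBinom_pos r).ne'
    rw [pow_succ]
    field_simp
  have := (fourPowDivCentralBinom_pos j).ne'
  rw [e, Nat.add_sub_cancel]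
  field_simp
  ring


theorem theorem6p2 (n : ℕ) (x : ℝ) (hx : |x| ≤ 1) (hx0 : n = 0 ∨ x ≠ 0) :
    (Even n →
      HasSum (fun i : ℕ => seriesTerm n x (i + 1))
        (((n.choose (n / 2) : ℝ) / (2 * (2 * x) ^ n)) *
          (Real.arcsin x ^ 4 / 6
            - Real.sqrt (1 - x ^ 2) / 3 * Real.arcsin x ^ 3 *
                ∑ j ∈ Finset.range (n / 2),
                  (2 * x) ^ (2 * j + 1) / (((2 * j).choose j : ℝ) * (2 * (j : ℝ) + 1))
            + Real.arcsin x ^ 2 / 2 *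
                ∑ j ∈ Finset.Icc 1 (n / 2),
                  ((2 * x) ^ (2 * j) / ((2 * j).choose j : ℝ) - 1) * (1 / (j : ℝ) ^ 2)
            + Real.sqrt (1 - x ^ 2) / 2 * Real.arcsin x *
                ∑ r ∈ Finset.range (n / 2),
                  (∑ j ∈ Finset.Icc (r + 1) (n / 2), 1 / (j : ℝ) ^ 2) *
                    ((2 * x) ^ (2 * r + 1) / (((2 * r).choose r : ℝ) * (2 * (r : ℝ) + 1)))
            - 1 / 4 *
                ∑ r ∈ Finset.Icc 1 (n / 2),
                  (∑ j ∈ Finset.Icc r (n / 2), 1 / (j : ℝ) ^ 2) *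
                    ((2 * x) ^ (2 * r) / (((2 * r).choose r : ℝ) * (r : ℝ) ^ 2))))) ∧
    (Odd n →
      HasSum (fun i : ℕ => seriesTerm n x (i + 1))
        (((2 / x) ^ n / ((n : ℝ) * ((n - 1).choose ((n - 1) / 2) : ℝ))) *
          (-(Real.sqrt (1 - x ^ 2) / 6) * Real.arcsin x ^ 3 *
                ∑ j ∈ Finset.Icc 0 ((n - 1) / 2),
                  ((2 * j).choose j : ℝ) * (x / 2) ^ (2 * j)
            + Real.arcsin x ^ 2 *
                ∑ j ∈ Finset.Icc 0 ((n - 1) / 2),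
                  ((2 * j).choose j : ℝ) * (x / 2) ^ (2 * j + 1) / (2 * (j : ℝ) + 1)
            + Real.sqrt (1 - x ^ 2) * Real.arcsin x *
                ∑ r ∈ Finset.Icc 0 ((n - 1) / 2),
                  (∑ j ∈ Finset.Icc r ((n - 1) / 2), 1 / (2 * (j : ℝ) + 1) ^ 2) *
                    (((2 * r).choose r : ℝ) * (x / 2) ^ (2 * r))
            - 2 *
                ∑ r ∈ Finset.Icc 0 ((n - 1) / 2),
                  (∑ j ∈ Finset.Icc r ((n - 1) / 2), 1 / (2 * (j : ℝ) + 1) ^ 2) *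
                    (((2 * r).choose r : ℝ) * (x / 2) ^ (2 * r + 1) / (2 * (r : ℝ) + 1))))) := by

  obtain ⟨hl, hu⟩ := abs_le.1 hx
  have hsin : sin (arcsin x) = x := sin_arcsin hl hu
  constructor
  · rintro ⟨m, rfl⟩
    have hc := fourPowDivCentralBinom_pos m
    -- Dividing by `2 * c m` normalises the derivative `2/3 * c m * t^3 * sin^(2m) t` to `sin^n t *
    -- t^3/3`.
    have h := hasSum_seriesTerm (n := m + m) (F := fun t => evenAntideriv m t / (2 * c m)) ?_
      (fun t => ((hasDerivAt_evenAntideriv m t).div_const _).congr_deriv ?_) hx hx0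
    · rw [evenAntideriv_eq, hsin, cos_arcsin] at h
      have e : (m + m) / 2 = m := by omega
      rw [e]
      convert h using 1
      rw [fourPowDivCentralBinom, Nat.centralBinom_eq_two_mul_choose, mul_pow, ← two_mul m,
        pow_mul 2]
      norm_num
      field_simp
    · simp [evenAntideriv, sqPartial]
    · rw [← two_mul]
      field_simp
  · rintro ⟨m, rfl⟩
    have hc := fourPowDivCentralBinom_pos m
    have h := hasSum_seriesTerm (n := 2 * m + 1)
      -- The factor comes from `2(m+1) / c (m+1) = (2m+1) / c m`, which makes the derivative
      -- `sin^(2m+1) t * t^3/3`.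
      (F := fun t => oddAntideriv (m + 1) t * (2 * c m / (2 * m + 1))) ?_
      (fun t => ((hasDerivAt_oddAntideriv (m + 1) t).mul_const _).congr_deriv ?_) hx hx0
    · rw [oddAntideriv_eq, hsin, cos_arcsin] at h
      have e : (2 * m + 1 - 1) / 2 = m := by omega
      rw [e, Nat.add_sub_cancel]
      convert h using 1
      rw [fourPowDivCentralBinom, Nat.centralBinom_eq_two_mul_choose, div_pow, pow_succ 2,
        pow_mul 2]
      have h2 : ((2 * m).choose m : ℝ) ≠ 0 := by exact_mod_cast (Nat.choose_pos (by omega)).ne'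
      push_cast
      norm_num
      field_simp
    · simp [oddAntideriv]
    · have e2 : 2 * (m + 1) - 1 = 2 * m + 1 := by omega
      rw [fourPowDivCentralBinom_succ, e2]
      push_cast
      field_simp
      ring
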